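/- Let $Q$ be a (small) involutive quantaloid: a category whose hom-sets are complete lattices, with composition preserving suprema in each variable, together with an order-preserving involution $(-)^\circ:Q^{\mathrm{op}}\to Q$ that is the identity on objects. A symmetric map is an arrow $f:x\to y$ with $\mathrm{id}_x\le f^\circ f$ and $ff^\circ\le \mathrm{id}_y$; the symmetric maps form a category $\mathrm{Map}_s(Q)$. A $Q$-category $(M,A)$ is a set $A$ with types $ta\in \mathrm{Ob}(Q)$ and arrows $M(a,b):tb\to ta$ such that $M(a,b)M(b,c)\le M(a,c)$ and $\mathrm{id}_{ta}\le M(a,a)$; it is symmetric if $M(a,b)=M(b,a)^\circ$, and skeletal if $M(-,a)=M(-,a')$ implies $a=a'$. A $Q$-functor is a type-preserving function $f$ with $M(a,b)\le N(fa,fb)$. A symmetric singleton of type $x$ of a symmetric $(M,A)$ is a family $\sigma(a):x\to ta$ with $M(a,b)\sigma(b)\le\sigma(a)$, $\mathrm{id}_x\le\bigvee_a\sigma(a)^\circ\sigma(a)$ and $\sigma(a)\sigma(b)^\circ\le M(a,b)$; $(M,A)$ is symmetrically complete if it is skeletal and every symmetric singleton is representable, i.e. of the form $M(-,a)$. Let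 $\mathrm{Cat}_{s\kappa}(Q)$ be the category of symmetrically complete symmetric $Q$-categories and $Q$-functors. Let $P:\mathrm{Cat}_{s\kappa}(Q)\to[\mathrm{Map}_s(Q)^{\mathrm{op}},\mathrm{Set}]$ send $(M,A)$ to $x\mapsto A_x=\{a: ta=x\}$, where a symmetric map $g:x\to y$ sends $a\in A_y$ to the element $a\cdot g$ of $A_x$ representing the singleton $M(-,a)g$. For a presheaf $F$ on $\mathrm{Map}_s(Q)$ let $\int F=\bigsqcup_x F(x)$ with $N(a,b)=\bigvee\{g:tb\to ta \text{ symmetric map}: F(g)(a)=b\}$, and let $S\int F$ be its symmetrization, with matrix $M_F(a,b)=N(a,b)\wedge N(b,a)^\circ$. Let $C_s$ be the symmetric completion: it sends $(M,A)$ to the $Q$-category of its symmetric singletons, with matrix $(\sigma,\tau)\mapsto\bigvee_a\sigma(a)^\circ\tau(a)$. Let $\mathrm{Cat}_{s\kappa}(Q)_f$ be the full subcategory of $\mathrm{Cat}_{s\kappa}(Q)$ on the $(M,A)$ such that for all $a,b\in A$ $$M(a,b)=\bigvee\{fg : c\in A,\ f:tc\to ta,\ g:tb\to tc \text{ symmetric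 maps},\ f\le M(a,c),\ g\le M(c,b)\}.$$ Call a family of symmetric maps $f_i:x_i\to q$ covering if $\mathrm{id}_q\le\bigvee_i f_if_i^\circ$. Let $[\mathrm{Map}_s(Q)^{\mathrm{op}},\mathrm{Set}]_f$ be the full subcategory of presheaves $F$ such that (a) (local representability) for every symmetric singleton $\sigma$ of $S\int F$, of type $q$, there are a covering family $f_i:x_i\to q$ and elements $s_i\in F(x_i)$ with $\sigma(a)f_i=M_F(a,s_i)$ for all $a\in\int F$ and all $i$; (b) (gluing) for every covering family $f_i:x_i\to q$ and elements $s_i\in F(x_i)$ with $f_i^\circ f_j\le M_F(s_i,s_j)$ for all $i,j$, there is a unique $s\in F(q)$ with $F(f_i)(s)=s_i$ for all $i$. (1) For every involutive quantaloid $Q$, the functors $C_sS\int$ and $P$ restrict to functors between $[\mathrm{Map}_s(Q)^{\mathrm{op}},\mathrm{Set}]_f$ and $\mathrm{Cat}_{s\kappa}(Q)_f$. The restricted functors are adjoint, $C_sS\int\dashv P$, with unit $F\to PC_sS\int F$, $a\mapsto M_F(-,a)$, and with counit sending the representable singleton $M(-,a)$ to $a$, and they form an equivalence of categories $$\mathrm{Cat}_{s\kappa}(Q)_f\simeq[\mathrm{Map}_s(Q)^{\mathrm{op}},\mathrm{Set}]_f.$$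 (2) (Walters) Let $X$ be a topological space and $R(X)$ the involutive quantaloid whose objects are the open subsets of $X$, whose arrows $U\to V$ are the open subsets $W\subseteq U\cap V$ ordered by inclusion, with intersection as composition and $W^\circ=W$. Sending $U\subseteq V$ to $U:U\to V$ is an equivalence from the category of open subsets of $X$ to $\mathrm{Map}_s(R(X))$, and, along it, $P$ induces an equivalence from $\mathrm{Cat}_{s\kappa}(R(X))$ to the category of sheaves of sets on $X$. -/

import Mathlib

open CategoryTheory Opposite

universe u

namespace QSheaf

/-! ### Involutive quantaloids -/

/-- A (small) quantaloid: a category whose hom-sets are complete lattices and whose composition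
preserves arbitrary suprema in each variable, i.e. a locally posetal, locally cocomplete and
closed bicategory. The composite `gf` of `f : x ⟶ y` and `g : y ⟶ z` is written `f ≫ g`. -/
class Quantaloid (Q : Type u) extends Category.{u} Q where
  homLattice (x y : Q) : CompleteLattice (x ⟶ y)
  sSup_comp {x y z : Q} (S : Set (x ⟶ y)) (g : y ⟶ z) :
    sSup S ≫ g = sSup ((fun f => f ≫ g) '' S)
  comp_sSup {x y z : Q} (f : x ⟶ y) (S : Set (y ⟶ z)) :
    f ≫ sSup S = sSup ((fun g => f ≫ g) '' S)

attribute [reducible, instance] Quantaloid.homLattice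

/-- An involutive quantaloid: `invol f : y ⟶ x` is the involute `f°` of `f : x ⟶ y`; the
involution is the identity on objects, reverses composition and preserves the order. -/
class InvolutiveQuantaloid (Q : Type u) extends Quantaloid Q where
  invol {x y : Q} (f : x ⟶ y) : (y ⟶ x)
  invol_invol {x y : Q} (f : x ⟶ y) : invol (invol f) = f
  invol_comp {x y z : Q} (f : x ⟶ y) (g : y ⟶ z) : invol (f ≫ g) = invol g ≫ invol f
  invol_mono {x y : Q} {f g : x ⟶ y} (h : f ≤ g) : invol f ≤ invol g

open Quantaloid InvolutiveQuantaloid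

section Basic

variable {Q : Type u} [Quantaloid Q]

theorem iSup_comp {ι : Sort*} {x y z : Q} (f : ι → (x ⟶ y)) (g : y ⟶ z) :
    (⨆ i, f i) ≫ g = ⨆ i, f i ≫ g := by
  rw [iSup, Quantaloid.sSup_comp, ← Set.range_comp]
  rfl

theorem comp_iSup {ι : Sort*} {x y z : Q} (f : x ⟶ y) (g : ι → (y ⟶ z)) :
    f ≫ (⨆ i, g i) = ⨆ i, f ≫ g i := by
  rw [iSup, Quantaloid.comp_sSup, ← Set.range_comp]
  rfl

theorem comp_le_comp {x y z : Q} {f f' : x ⟶ y} {g g' : y ⟶ z} (hf : f ≤ f') (hg : g ≤ g') :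
    f ≫ g ≤ f' ≫ g' := by
  have h1 : f ≫ g ≤ f' ≫ g := by
    have h : sSup {f, f'} = f' := by rw [sSup_pair]; exact sup_eq_right.2 hf
    have h2 := Quantaloid.sSup_comp {f, f'} g
    rw [h] at h2
    rw [h2]
    exact le_sSup ⟨f, by simp, rfl⟩
  have h3 : f' ≫ g ≤ f' ≫ g' := by
    have h : sSup {g, g'} = g' := by rw [sSup_pair]; exact sup_eq_right.2 hg
    have h2 := Quantaloid.comp_sSup f' {g, g'}
    rw [h] at h2
    rw [h2]
    exact le_sSup ⟨g, by simp, rfl⟩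
  exact h1.trans h3

end Basic

section Invol

variable {Q : Type u} [InvolutiveQuantaloid Q]

theorem invol_le_iff {x y : Q} {f : x ⟶ y} {g : y ⟶ x} : invol f ≤ g ↔ f ≤ invol g := by
  constructor
  · intro h
    have h' := invol_mono h
    rwa [invol_invol] at h'
  · intro h
    have h' := invol_mono h
    rwa [invol_invol] at h'

theorem invol_id (x : Q) : invol (𝟙 x) = 𝟙 x := by
  have h := invol_comp (invol (𝟙 x)) (𝟙 x)
  rw [Category.comp_id, invol_invol, Category.comp_id] at h
  exact h.symm

theorem invol_iSup {ι : Sort*} {x y : Q} (f : ι → (x ⟶ y)) :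
    invol (⨆ i, f i) = ⨆ i, invol (f i) := by
  apply le_antisymm
  · rw [invol_le_iff]
    exact iSup_le fun i => invol_le_iff.1 (le_iSup (fun i => invol (f i)) i)
  · exact iSup_le fun i => invol_mono (le_iSup f i)

theorem invol_inf {x y : Q} (f g : x ⟶ y) : invol (f ⊓ g) = invol f ⊓ invol g := by
  apply le_antisymm
  · exact le_inf (invol_mono inf_le_left) (invol_mono inf_le_right)
  · have h : invol (invol f ⊓ invol g) ≤ f ⊓ g :=
      le_inf (invol_le_iff.2 inf_le_left) (invol_le_iff.2 inf_le_right)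
    exact invol_le_iff.1 h

end Invol

/-! ### Symmetric maps -/

section SymMaps

variable (Q : Type u) [InvolutiveQuantaloid Q]

/-- Symmetric maps: 1-cells `f : x ⟶ y` that are left adjoint to their involute, i.e.
`id_x ≤ f°f` and `ff° ≤ id_y`. -/
def symMap : MorphismProperty Q := fun x y f => 𝟙 x ≤ f ≫ invol f ∧ invol f ≫ f ≤ 𝟙 y

instance : (symMap Q).IsMultiplicative where
  id_mem x := by
    simp [symMap, invol_id]
  comp_mem {x y z} f g hf hg := by
    refine ⟨?_, ?_⟩
    · calc 𝟙 x ≤ f ≫ invol f := hf.1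
        _ = f ≫ 𝟙 y ≫ invol f := by simp
        _ ≤ f ≫ (g ≫ invol g) ≫ invol f :=
          comp_le_comp le_rfl (comp_le_comp hg.1 le_rfl)
        _ = (f ≫ g) ≫ invol (f ≫ g) := by simp [invol_comp]
    · calc invol (f ≫ g) ≫ f ≫ g = invol g ≫ (invol f ≫ f) ≫ g := by simp [invol_comp]
        _ ≤ invol g ≫ 𝟙 y ≫ g := comp_le_comp le_rfl (comp_le_comp hf.2 le_rfl)
        _ ≤ 𝟙 z := by simpa using hg.2

/-- The category `Map_s(Q)` of symmetric maps. Two symmetric maps `f ≤ g` are equal, so that its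
2-structure is trivial. -/
abbrev MapS : Type u := WideSubcategory (symMap Q)

/-- Set-valued presheaves on `Map_s(Q)`. -/
abbrev PSh : Type (u + 1) := (MapS Q)ᵒᵖ ⥤ Type u

/-- A family of symmetric maps `f i : x i ⟶ q` is covering if `id_q ≤ ⋁ (f i)(f i)°`. -/
def Covering {Q : Type u} [InvolutiveQuantaloid Q] {I : Type u} {x : I → MapS Q} {q : MapS Q}
    (f : ∀ i, x i ⟶ q) : Prop :=
  𝟙 q.obj ≤ ⨆ i, invol (f i).hom ≫ (f i).hom

end SymMaps

/-! ### Categories enriched in a quantaloid -/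

/-- A `Q`-category. The underlying `Ob(Q)`-typed set is given by its fibres: `El x` is the set of
elements of type `x`. For `a` of type `x` and `b` of type `y`, `hom a b : y ⟶ x` is the matrix
entry `M(a,b)`. All coherence conditions are automatic as `Q` is locally posetal. -/
structure QCat (Q : Type u) [Quantaloid Q] where
  El : Q → Type u
  hom {x y : Q} (a : El x) (b : El y) : (y ⟶ x)
  comp_le {x y z : Q} (a : El x) (b : El y) (c : El z) : hom b c ≫ hom a b ≤ hom a c
  id_le {x : Q} (a : El x) : 𝟙 x ≤ hom a a

namespace QCat

section Basic

variable {Q : Type u} [Quantaloid Q]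

/-- `Q`-functors: type-preserving functions with `M(a,b) ≤ N(f a, f b)`. -/
@[ext]
structure Hom (A B : QCat Q) where
  map (x : Q) : A.El x → B.El x
  hom_le {x y : Q} (a : A.El x) (b : A.El y) : A.hom a b ≤ B.hom (map x a) (map y b)

instance : Category (QCat Q) where
  Hom A B := Hom A B
  id A := { map := fun _ a => a, hom_le := fun _ _ => le_rfl }
  comp f g :=
    { map := fun x a => g.map x (f.map x a)
      hom_le := fun a b => (f.hom_le a b).trans (g.hom_le _ _) }

/-- `A` is skeletal: elements `a`, `a'` with `M(-,a) = M(-,a')` are equal. -/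
def Skeletal (A : QCat Q) : Prop :=
  ∀ (x : Q) (a a' : A.El x), (∀ (y : Q) (b : A.El y), A.hom b a = A.hom b a') → a = a'

end Basic

variable {Q : Type u} [InvolutiveQuantaloid Q]

/-- `A` is symmetric: `M(a,b) = M(b,a)°`. -/
def IsSymm (A : QCat Q) : Prop :=
  ∀ (x y : Q) (a : A.El x) (b : A.El y), A.hom a b = invol (A.hom b a)

end QCat

/-- The category of symmetric `Q`-categories, full in the category of `Q`-categories. -/
abbrev SymQCat (Q : Type u) [InvolutiveQuantaloid Q] : Type (u + 1) :=
  ObjectProperty.FullSubcategory (fun A : QCat Q => A.IsSymm)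

/-- A symmetric singleton of type `x` of a symmetric `Q`-category `A`: a distributor `σ` from the
one-element `Q`-category `(id_x, x)` to `A` with matrix entries `σ a : x ⟶ ta` which is left
adjoint to its involute `σ°`. The fields `unit` and `counit` are the inequalities
`id_x ≤ ⋁_a σ(a)°σ(a)` and `σ(a)σ(b)° ≤ M(a,b)`. -/
@[ext]
structure SymSingleton {Q : Type u} [InvolutiveQuantaloid Q] (A : SymQCat Q) (x : Q) where
  val (y : Q) (a : A.obj.El y) : (x ⟶ y)
  act {y z : Q} (a : A.obj.El y) (b : A.obj.El z) : val z b ≫ A.obj.hom a b ≤ val y a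
  unit : 𝟙 x ≤ ⨆ (y : Q) (a : A.obj.El y), val y a ≫ invol (val y a)
  counit {y z : Q} (a : A.obj.El y) (b : A.obj.El z) :
    invol (val z b) ≫ val y a ≤ A.obj.hom a b

section Singletons

variable {Q : Type u} [InvolutiveQuantaloid Q]

/-- The singleton `M(-,a)g`, for an element `a` of type `y` and a symmetric map `g : x ⟶ y`. -/
def SymSingleton.ofMap (A : SymQCat Q) {x y : MapS Q} (a : A.obj.El y.obj) (g : x ⟶ y) :
    SymSingleton A x.obj where
  val z b := g.hom ≫ A.obj.hom b a
  act b c := by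
    rw [Category.assoc]
    exact comp_le_comp le_rfl (A.obj.comp_le _ _ _)
  unit := by
    refine le_trans ?_ (le_iSup₂_of_le y.obj a le_rfl)
    rw [invol_comp, ← A.property]
    calc 𝟙 x.obj ≤ g.hom ≫ invol g.hom := g.property.1
      _ = (g.hom ≫ 𝟙 _) ≫ 𝟙 _ ≫ invol g.hom := by simp
      _ ≤ _ := comp_le_comp (comp_le_comp le_rfl (A.obj.id_le a))
        (comp_le_comp (A.obj.id_le a) le_rfl)
  counit b c := by
    rw [invol_comp, ← A.property]
    calc (A.obj.hom a c ≫ invol g.hom) ≫ g.hom ≫ A.obj.hom b a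
        = A.obj.hom a c ≫ (invol g.hom ≫ g.hom) ≫ A.obj.hom b a := by simp
      _ ≤ A.obj.hom a c ≫ 𝟙 _ ≫ A.obj.hom b a :=
        comp_le_comp le_rfl (comp_le_comp g.property.2 le_rfl)
      _ ≤ _ := by simpa using A.obj.comp_le _ _ _

/-- The representable singleton `M(-,a)`. -/
def SymSingleton.repr (A : SymQCat Q) {x : Q} (a : A.obj.El x) : SymSingleton A x where
  val y b := A.obj.hom b a
  act b c := A.obj.comp_le _ _ _
  unit := by
    refine le_trans ?_ (le_iSup₂_of_le x a le_rfl)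
    rw [← A.property]
    simpa using comp_le_comp (A.obj.id_le a) (A.obj.id_le a)
  counit b c := by
    rw [← A.property]
    exact A.obj.comp_le _ _ _

/-- A symmetric `Q`-category (skeletal, as in the definition of completeness by singletons) is
symmetrically complete if each of its symmetric singletons is representable. -/
def IsSymComplete (A : SymQCat Q) : Prop :=
  A.obj.Skeletal ∧
    ∀ (x : Q) (σ : SymSingleton A x), ∃ a : A.obj.El x, σ = SymSingleton.repr A a

end Singletons

/-- The category of (skeletal) symmetrically complete symmetric `Q`-categories. -/
abbrev CatSK (Q : Type u) [InvolutiveQuantaloid Q] : Type (u + 1) :=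
  ObjectProperty.FullSubcategory (fun A : SymQCat Q => IsSymComplete A)

/-! ### The symmetric completion -/

section Completion

variable {Q : Type u} [InvolutiveQuantaloid Q]

/-- The `Q`-category of symmetric singletons of `A`, with matrix `σ°τ = ⋁_a σ(a)°τ(a)`. -/
def singletonCat (A : SymQCat Q) : SymQCat Q where
  obj :=
    { El := fun x => SymSingleton A x
      hom := fun σ τ => ⨆ (z : Q) (a : A.obj.El z), τ.val z a ≫ invol (σ.val z a)
      comp_le := by
        intro x y z σ τ υ
        simp only [iSup_comp, comp_iSup]
        refine iSup₂_le fun p a => iSup₂_le fun q b => ?_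
        refine le_trans ?_ (le_iSup₂_of_le p a le_rfl)
        calc (υ.val q b ≫ invol (τ.val q b)) ≫ τ.val p a ≫ invol (σ.val p a)
            = (υ.val q b ≫ invol (τ.val q b) ≫ τ.val p a) ≫ invol (σ.val p a) := by simp
          _ ≤ (υ.val q b ≫ A.obj.hom a b) ≫ invol (σ.val p a) :=
            comp_le_comp (comp_le_comp le_rfl (τ.counit a b)) le_rfl
          _ ≤ _ := comp_le_comp (υ.act a b) le_rfl
      id_le := fun σ => σ.unit }
  property := by
    intro x y σ τ
    simp only [invol_iSup, invol_comp, invol_invol]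

theorem singletonCat_hom_repr (A : SymQCat Q) {x y : Q} (a : A.obj.El y) (σ : SymSingleton A x) :
    (singletonCat A).obj.hom (SymSingleton.repr A a : (singletonCat A).obj.El y) σ =
      σ.val y a := by
  apply le_antisymm
  · refine iSup₂_le fun z b => ?_
    have h : invol ((SymSingleton.repr A a).val z b) = A.obj.hom a b := (A.property _ _ _ _).symm
    rw [h]
    exact σ.act a b
  · refine le_trans ?_ (le_iSup₂_of_le y a le_rfl)
    have h : invol ((SymSingleton.repr A a).val y a) = A.obj.hom a a := (A.property _ _ _ _).symm
    rw [h]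
    simpa using comp_le_comp (le_refl (σ.val y a)) (A.obj.id_le a)

theorem singletonCat_isSymComplete (A : SymQCat Q) : IsSymComplete (singletonCat A) := by
  refine ⟨?_, ?_⟩
  · intro x σ τ h
    apply SymSingleton.ext
    funext y a
    have h' := h y (SymSingleton.repr A a)
    exact (singletonCat_hom_repr A a σ).symm.trans (h'.trans (singletonCat_hom_repr A a τ))
  · intro x ψ
    have key : ∀ (y : Q) (σ : SymSingleton A y) (z : Q) (a : A.obj.El z),
        ψ.val y σ ≫ σ.val z a ≤ ψ.val z (SymSingleton.repr A a) := by
      intro y σ z a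
      have h := ψ.act (SymSingleton.repr A a : (singletonCat A).obj.El z) σ
      rwa [singletonCat_hom_repr] at h
    let σ₀ : SymSingleton A x :=
      { val := fun y a => ψ.val y (SymSingleton.repr A a)
        act := fun a b => key _ (SymSingleton.repr A b) _ a
        unit := by
          refine ψ.unit.trans (iSup₂_le fun y σ => ?_)
          calc ψ.val y σ ≫ invol (ψ.val y σ) = ψ.val y σ ≫ 𝟙 y ≫ invol (ψ.val y σ) := by simp
            _ ≤ ψ.val y σ ≫ (⨆ (z : Q) (a : A.obj.El z), σ.val z a ≫ invol (σ.val z a)) ≫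
                invol (ψ.val y σ) := comp_le_comp le_rfl (comp_le_comp σ.unit le_rfl)
            _ ≤ _ := by
              simp only [iSup_comp, comp_iSup]
              refine iSup₂_mono fun z a => ?_
              calc ψ.val y σ ≫ (σ.val z a ≫ invol (σ.val z a)) ≫ invol (ψ.val y σ)
                  = (ψ.val y σ ≫ σ.val z a) ≫ invol (ψ.val y σ ≫ σ.val z a) := by
                    simp [invol_comp]
                _ ≤ _ := comp_le_comp (key y σ z a) (invol_mono (key y σ z a))
        counit := by
          intro y z a b
          refine (ψ.counit (SymSingleton.repr A a : (singletonCat A).obj.El y)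
            (SymSingleton.repr A b : (singletonCat A).obj.El z)).trans ?_
          rw [singletonCat_hom_repr]
          exact le_rfl }
    refine ⟨σ₀, ?_⟩
    apply SymSingleton.ext
    funext y τ
    apply le_antisymm
    · calc ψ.val y τ = ψ.val y τ ≫ 𝟙 y := by simp
        _ ≤ ψ.val y τ ≫ (⨆ (z : Q) (a : A.obj.El z), τ.val z a ≫ invol (τ.val z a)) :=
          comp_le_comp le_rfl τ.unit
        _ ≤ _ := by
          simp only [comp_iSup]
          refine iSup₂_mono fun z a => ?_
          rw [← Category.assoc]
          exact comp_le_comp (key y τ z a) le_rfl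
    · refine iSup₂_le fun z a => ?_
      have h := ψ.act τ (SymSingleton.repr A a : (singletonCat A).obj.El z)
      have h' : (singletonCat A).obj.hom τ (SymSingleton.repr A a : (singletonCat A).obj.El z) =
          invol (τ.val z a) :=
        ((singletonCat A).property _ _ _ _).trans
          (congrArg invol (singletonCat_hom_repr A a τ))
      exact (comp_le_comp le_rfl h'.ge).trans h

/-- The singleton `f_! σ`, with entries `(f_! σ)(b) = ⋁_a N(b, f a)σ(a)`. -/
def SymSingleton.push {A B : SymQCat Q} (f : A ⟶ B) {x : Q} (σ : SymSingleton A x) :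
    SymSingleton B x where
  val y b := ⨆ (z : Q) (a : A.obj.El z), σ.val z a ≫ B.obj.hom b (f.hom.map z a)
  act b c := by
    simp only [iSup_comp]
    refine iSup₂_mono fun z a => ?_
    rw [Category.assoc]
    exact comp_le_comp le_rfl (B.obj.comp_le _ _ _)
  unit := by
    refine σ.unit.trans (iSup₂_le fun z a => le_iSup₂_of_le z (f.hom.map z a) ?_)
    have h : σ.val z a ≤ ⨆ (w : Q) (c : A.obj.El w),
        σ.val w c ≫ B.obj.hom (f.hom.map z a) (f.hom.map w c) :=
      le_iSup₂_of_le z a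
        (by simpa using comp_le_comp (le_refl (σ.val z a)) (B.obj.id_le (f.hom.map z a)))
    exact comp_le_comp h (invol_mono h)
  counit b c := by
    simp only [invol_iSup, iSup_comp, comp_iSup]
    refine iSup₂_le fun z a => iSup₂_le fun w d => ?_
    rw [invol_comp, ← B.property]
    calc (B.obj.hom (f.hom.map w d) c ≫ invol (σ.val w d)) ≫
          σ.val z a ≫ B.obj.hom b (f.hom.map z a)
        = B.obj.hom (f.hom.map w d) c ≫ (invol (σ.val w d) ≫ σ.val z a) ≫
          B.obj.hom b (f.hom.map z a) := by simp
      _ ≤ B.obj.hom (f.hom.map w d) c ≫ B.obj.hom (f.hom.map z a) (f.hom.map w d) ≫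
          B.obj.hom b (f.hom.map z a) :=
        comp_le_comp le_rfl (comp_le_comp ((σ.counit a d).trans (QCat.Hom.hom_le f.hom a d)) le_rfl)
      _ ≤ B.obj.hom (f.hom.map w d) c ≫ B.obj.hom b (f.hom.map w d) :=
        comp_le_comp le_rfl (B.obj.comp_le _ _ _)
      _ ≤ _ := B.obj.comp_le _ _ _

theorem SymSingleton.push_id {A : SymQCat Q} {x : Q} (σ : SymSingleton A x) :
    SymSingleton.push (𝟙 A) σ = σ := by
  apply SymSingleton.ext
  funext y b
  apply le_antisymm
  · exact iSup₂_le fun z a => σ.act b a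
  · refine le_iSup₂_of_le y b ?_
    exact le_trans (by simp) (comp_le_comp (le_refl (σ.val y b)) (A.obj.id_le b))

theorem SymSingleton.push_comp {A B C : SymQCat Q} (f : A ⟶ B) (g : B ⟶ C) {x : Q}
    (σ : SymSingleton A x) :
    SymSingleton.push (f ≫ g) σ = SymSingleton.push g (SymSingleton.push f σ) := by
  apply SymSingleton.ext
  funext y c
  apply le_antisymm
  · refine iSup₂_le fun z a => le_iSup₂_of_le z (f.hom.map z a) ?_
    refine comp_le_comp ?_ le_rfl
    refine le_iSup₂_of_le z a ?_
    exact le_trans (by simp) (comp_le_comp (le_refl (σ.val z a)) (B.obj.id_le (f.hom.map z a)))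
  · refine iSup₂_le fun w b => ?_
    simp only [SymSingleton.push, iSup_comp]
    refine iSup₂_mono fun z a => ?_
    rw [Category.assoc]
    exact comp_le_comp le_rfl
      ((comp_le_comp (QCat.Hom.hom_le g.hom _ _) le_rfl).trans (C.obj.comp_le _ _ _))

variable (Q) in
/-- The symmetric completion functor `C_s`. -/
def completion : SymQCat Q ⥤ CatSK Q where
  obj A := ⟨singletonCat A, singletonCat_isSymComplete A⟩
  map {A B} f := ObjectProperty.homMk (ObjectProperty.homMk
    { map := fun _ σ => SymSingleton.push f σ
      hom_le := by
        intro x y σ τ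
        refine iSup₂_le fun z a => le_iSup₂_of_le z (f.hom.map z a) ?_
        have h : ∀ (w : Q) (υ : SymSingleton A w),
            υ.val z a ≤ (SymSingleton.push f υ).val z (f.hom.map z a) := fun w υ =>
          le_iSup₂_of_le z a (le_trans (by simp)
            (comp_le_comp (le_refl (υ.val z a)) (B.obj.id_le (f.hom.map z a))))
        exact comp_le_comp (h _ τ) (invol_mono (h _ σ)) })
  map_id A := by
    apply ObjectProperty.hom_ext
    apply ObjectProperty.hom_ext
    apply QCat.Hom.ext
    funext x σ
    exact SymSingleton.push_id σ
  map_comp f g := by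
    apply ObjectProperty.hom_ext
    apply ObjectProperty.hom_ext
    apply QCat.Hom.ext
    funext x σ
    exact SymSingleton.push_comp f g σ

end Completion

/-! ### Symmetrization and the category of elements of a presheaf -/

section Elements

variable (Q : Type u) [InvolutiveQuantaloid Q]

/-- The symmetrization functor `S`: same elements, with matrix `M_s(a,b) = M(a,b) ∧ M(b,a)°`. -/
def symmetrization : QCat Q ⥤ SymQCat Q where
  obj A :=
    { obj :=
        { El := A.El
          hom := fun a b => A.hom a b ⊓ invol (A.hom b a)
          comp_le := by
            intro x y z a b c
            refine le_inf ?_ ?_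
            · exact (comp_le_comp inf_le_left inf_le_left).trans (A.comp_le a b c)
            · refine (comp_le_comp inf_le_right inf_le_right).trans ?_
              rw [← invol_comp]
              exact invol_mono (A.comp_le c b a)
          id_le := by
            intro x a
            refine le_inf (A.id_le a) ?_
            rw [← invol_le_iff, invol_id]
            exact A.id_le a }
      property := by
        intro x y a b
        simp only [invol_inf, invol_invol]
        exact inf_comm _ _ }
  map f := ObjectProperty.homMk
    { map := f.map
      hom_le := fun a b =>
        inf_le_inf (QCat.Hom.hom_le f a b) (invol_mono (QCat.Hom.hom_le f b a)) }

variable {Q} in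
/-- The `Q`-category of elements `∫F` of a presheaf `F` on `Map_s(Q)`: elements of type `x` are
the elements of `F(x)`, and `M(a,b)` is the supremum of the symmetric maps `g : tb ⟶ ta` with
`F(g)(a) = b`. -/
def elementsObj (F : PSh Q) : QCat Q where
  El x := F.obj (op ⟨x⟩)
  hom {x y} a b := ⨆ (g : (⟨y⟩ : MapS Q) ⟶ ⟨x⟩) (_ : F.map g.op a = b), g.hom
  comp_le {x y z} a b c := by
    simp only [iSup_comp, comp_iSup]
    refine iSup₂_le fun g hg => iSup₂_le fun h hh => ?_
    refine le_iSup₂_of_le (h ≫ g) ?_ le_rfl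
    simp [hg, hh]
  id_le {x} a := le_iSup₂_of_le (𝟙 (⟨x⟩ : MapS Q)) (by simp) le_rfl

/-- The functor `∫`. -/
def elements : PSh Q ⥤ QCat Q where
  obj F := elementsObj F
  map {F G} α :=
    { map := fun x a => α.app (op ⟨x⟩) a
      hom_le := by
        intro x y a b
        refine iSup₂_le fun g hg => le_iSup₂_of_le g ?_ le_rfl
        rw [← hg]
        exact (NatTrans.naturality_apply α g.op a).symm }

/-- The functor `S∫`. -/
abbrev symElements : PSh Q ⥤ SymQCat Q := elements Q ⋙ symmetrization Q

end Elements

/-! ### The presheaf of fibres -/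

section Fibres

variable {Q : Type u} [InvolutiveQuantaloid Q]

theorem SymQCat.hom_eq_of_le (A : SymQCat Q) {x y : MapS Q} (g : x ⟶ y) (a : A.obj.El y.obj)
    (c : A.obj.El x.obj) (h : g.hom ≤ A.obj.hom a c) {z : Q} (b : A.obj.El z) :
    A.obj.hom b c = g.hom ≫ A.obj.hom b a := by
  apply le_antisymm
  · have h' : invol g.hom ≤ A.obj.hom c a := by
      rw [A.property]
      exact invol_mono h
    calc A.obj.hom b c = 𝟙 _ ≫ A.obj.hom b c := by simp
      _ ≤ (g.hom ≫ invol g.hom) ≫ A.obj.hom b c := comp_le_comp g.property.1 le_rfl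
      _ = g.hom ≫ invol g.hom ≫ A.obj.hom b c := by simp
      _ ≤ g.hom ≫ A.obj.hom c a ≫ A.obj.hom b c :=
        comp_le_comp le_rfl (comp_le_comp h' le_rfl)
      _ ≤ _ := comp_le_comp le_rfl (A.obj.comp_le _ _ _)
  · exact (comp_le_comp h le_rfl).trans (A.obj.comp_le _ _ _)

/-- The element `a · g` that represents the singleton `M(-,a)g`. -/
noncomputable def CatSK.restr (A : CatSK Q) {x y : MapS Q} (a : A.obj.obj.El y.obj) (g : x ⟶ y) :
    A.obj.obj.El x.obj :=
  (A.property.2 x.obj (SymSingleton.ofMap A.obj a g)).choose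

theorem CatSK.hom_restr (A : CatSK Q) {x y : MapS Q} (a : A.obj.obj.El y.obj) (g : x ⟶ y)
    {z : Q} (b : A.obj.obj.El z) :
    A.obj.obj.hom b (A.restr a g) = g.hom ≫ A.obj.obj.hom b a := by
  have h := (A.property.2 x.obj (SymSingleton.ofMap A.obj a g)).choose_spec
  exact (congrFun (congrFun (congrArg SymSingleton.val h) z) b).symm

/-- The presheaf `P_A` of fibres: `P_A(x) = A_x` and `P_A(g)(a) = a · g`. -/
noncomputable def fibresObj (A : CatSK Q) : PSh Q where
  obj x := A.obj.obj.El x.unop.obj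
  map g := TypeCat.ofHom fun a => A.restr a g.unop
  map_id x := by
    ext a
    apply A.property.1
    intro y b
    simp [CatSK.hom_restr]
  map_comp f g := by
    ext a
    apply A.property.1
    intro y b
    simp [CatSK.hom_restr]

variable (Q) in
/-- The functor `P`. -/
noncomputable def fibres : CatSK Q ⥤ PSh Q where
  obj A := fibresObj A
  map {A B} f :=
    { app := fun x => TypeCat.ofHom fun a => f.hom.hom.map x.unop.obj a
      naturality := by
        intro x y g
        ext a
        apply B.property.1
        intro z b
        change B.obj.obj.hom b (f.hom.hom.map _ (A.restr a g.unop)) =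
          B.obj.obj.hom b (B.restr (f.hom.hom.map _ a) g.unop)
        rw [CatSK.hom_restr]
        apply SymQCat.hom_eq_of_le
        refine le_trans ?_ (QCat.Hom.hom_le f.hom.hom a (A.restr a g.unop))
        refine le_trans ?_ (CatSK.hom_restr A a g.unop a).ge
        exact le_trans (by simp) (comp_le_comp (le_refl g.unop.hom) (A.obj.obj.id_le a)) }

variable (Q) in
/-- The functor `C_s S ∫`. -/
abbrev sheafification : PSh Q ⥤ CatSK Q := symElements Q ⋙ completion Q

end Fibres

/-! ### The two full subcategories -/

section Fixed

variable (Q : Type u) [InvolutiveQuantaloid Q]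

/-- The map-supremum condition: for all `a`, `b`, the entry `M(a,b)` is the supremum of the
composites `fg` of symmetric maps `f : tc ⟶ ta` and `g : tb ⟶ tc`, for some element `c`, with
`f ≤ M(a,c)` and `g ≤ M(c,b)`. -/
def MapSupremum : ObjectProperty (CatSK Q) := fun A =>
  ∀ (x y : MapS Q) (a : A.obj.obj.El x.obj) (b : A.obj.obj.El y.obj),
    A.obj.obj.hom a b =
      sSup {h : y.obj ⟶ x.obj | ∃ (z : MapS Q) (c : A.obj.obj.El z.obj) (f : z ⟶ x) (g : y ⟶ z),
        f.hom ≤ A.obj.obj.hom a c ∧ g.hom ≤ A.obj.obj.hom c b ∧ h = g.hom ≫ f.hom}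

variable {Q}

/-- Every symmetric singleton `σ` of `S∫F` is locally representable: for some covering family
`f i : x i ⟶ tσ` and elements `s i` of `F (x i)`, one has `σ(a)(f i) = M(a, s i)` for all `a`. -/
def LocallyRepresentable (F : PSh Q) : Prop :=
  ∀ (q : MapS Q) (σ : SymSingleton ((symElements Q).obj F) q.obj),
    ∃ (I : Type u) (x : I → MapS Q) (f : ∀ i, x i ⟶ q) (s : ∀ i, F.obj (op (x i))),
      Covering f ∧
        ∀ (i : I) (y : Q) (a : F.obj (op ⟨y⟩)),
          (f i).hom ≫ σ.val y a =
            ((symElements Q).obj F).obj.hom (x := y) (y := (x i).obj) a (s i)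

/-- Gluing: for every covering family `f i : x i ⟶ q` with elements `s i` of `F (x i)` that are
compatible, i.e. `(f i)°(f j) ≤ M(s i, s j)` in `S∫F`, there is a unique `t` in `F q` with
`F (f i) t = s i` for all `i`. -/
def UniqueGluing (F : PSh Q) : Prop :=
  ∀ (q : MapS Q) (I : Type u) (x : I → MapS Q) (f : ∀ i, x i ⟶ q) (s : ∀ i, F.obj (op (x i))),
    Covering f →
    (∀ i j, (f j).hom ≫ invol (f i).hom ≤
      ((symElements Q).obj F).obj.hom (x := (x i).obj) (y := (x j).obj) (s i) (s j)) →
    ∃! t : F.obj (op q), ∀ i, F.map (f i).op t = s i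

variable (Q)

/-- The presheaves that satisfy local representability and gluing. -/
def GluingCondition : ObjectProperty (PSh Q) := fun F => LocallyRepresentable F ∧ UniqueGluing F

/-- The full subcategory of symmetrically complete `Q`-categories with the map-supremum
condition. -/
abbrev CatSKf : Type (u + 1) := (MapSupremum Q).FullSubcategory

/-- The full subcategory of presheaves with the local representability and gluing conditions. -/
abbrev PShf : Type (u + 1) := (GluingCondition Q).FullSubcategory

end Fixed

/-! ### The quantaloid of open subsets of a topological space -/

open TopologicalSpace

/-- The objects of the quantaloid `R(X)`: the open subsets of `X`. -/
structure OpenRel (X : Type u) [TopologicalSpace X] : Type u where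
  of ::
  carrier : Opens X

section OpenRel

variable {X : Type u} [TopologicalSpace X]

/-- The quantaloid `R(X)`: a 1-cell `U ⟶ V` is an open subset `W ≤ U ∧ V`, 2-cells are
inclusions, composition is intersection, and the identity of `U` is `U`; the involute of
`W : U ⟶ V` is `W : V ⟶ U`. -/
instance : InvolutiveQuantaloid (OpenRel X) where
  Hom U V := Set.Iic (U.carrier ⊓ V.carrier)
  id U := ⟨U.carrier, Set.mem_Iic.2 (le_inf le_rfl le_rfl)⟩
  comp f g := ⟨f.1 ⊓ g.1, Set.mem_Iic.2
    (le_inf (inf_le_left.trans ((Set.mem_Iic.1 f.2).trans inf_le_left))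
      (inf_le_right.trans ((Set.mem_Iic.1 g.2).trans inf_le_right)))⟩
  id_comp f := Subtype.ext (inf_eq_right.2 (f.2.trans inf_le_left))
  comp_id f := Subtype.ext (inf_eq_left.2 (f.2.trans inf_le_right))
  assoc f g h := Subtype.ext (inf_assoc _ _ _)
  homLattice U V := inferInstanceAs (CompleteLattice (Set.Iic (U.carrier ⊓ V.carrier)))
  sSup_comp S g := by
    apply Subtype.ext
    change sSup (Subtype.val '' S) ⊓ g.1 = sSup (Subtype.val '' _)
    rw [sSup_inf_eq, Set.image_image, sSup_image, iSup_image]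
  comp_sSup f S := by
    apply Subtype.ext
    change f.1 ⊓ sSup (Subtype.val '' S) = sSup (Subtype.val '' _)
    rw [inf_sSup_eq, Set.image_image, sSup_image, iSup_image]
  invol f := ⟨f.1, Set.mem_Iic.2
    (le_inf ((Set.mem_Iic.1 f.2).trans inf_le_right) ((Set.mem_Iic.1 f.2).trans inf_le_left))⟩
  invol_invol f := rfl
  invol_comp f g := Subtype.ext (inf_comm _ _)
  invol_mono h := h

/-- The functor from open subsets to symmetric maps in `R(X)`, which sends an inclusion `U ≤ V`
to `U : U ⟶ V`. -/
def opensToMapS : Opens X ⥤ MapS (OpenRel X) where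
  obj U := ⟨OpenRel.of U⟩
  map {U V} i :=
    { hom := (⟨U, le_inf le_rfl (leOfHom i)⟩ : Set.Iic (U ⊓ V))
      property := ⟨show U ≤ U ⊓ U from le_inf le_rfl le_rfl,
        show U ⊓ U ≤ V from inf_le_left.trans (leOfHom i)⟩ }
  map_id U := rfl
  map_comp {U V W} i j := by
    apply WideSubcategory.hom_ext
    exact Subtype.ext (inf_eq_left.2 (leOfHom i)).symm

end OpenRel

end QSheaf

/-! Both halves rest on one translation: in a symmetrically complete category, `a · g = b` holds
exactly when `g ≤ M(a,b)` (`CatSK.restr_eq_iff`). The action of symmetric maps can thus be read off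
the matrix, and the matrix can be recovered from the action whenever its entries are suprema of
symmetric maps.

Part (1) says that on the two subcategories each construction undoes the other. For a map-supremum
`A`, the matrix of `∫P_A` is already that of `A` (`symElements_fibres_hom`), so singletons of
`S∫P_A` are singletons of `A`, hence representable. For a presheaf `F` with (a) and (b), the same
translation holds in the form `F(f)(s) = t ↔ f ≤ M_F(s,t)` (`GluingCondition.map_eq_iff`). Local
representability and gluing then make every singleton of `S∫F` representable
(`GluingCondition.isSymComplete`), so that `C_s` adds no elements. Unit and counit are therefore
invertible, and every remaining check reduces to representables.

Part (2) is proved directly. A symmetric map in `R(X)` is just an inclusion, and `M(a,b)` is the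
largest open set on which `a` and `b` have equal restrictions (`CatSK.le_homOpen_iff`); hence `P` is
fully faithful. Fibres form sheaves because complete categories have unique gluing. Conversely, the
sections of a sheaf form a category whose matrix is the locus of agreement, and a singleton of it is
gluing data for one section. -/

namespace QSheaf

open Quantaloid InvolutiveQuantaloid

/-! ### Gluing and map suprema in symmetrically complete categories -/

section Completeness

variable {Q : Type u} [InvolutiveQuantaloid Q]

/-- An arrow out of the target of a covering family is determined by its restrictions. -/
theorem Covering.eq_iSup {I : Type u} {x : I → MapS Q} {q : MapS Q} {f : ∀ i, x i ⟶ q}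
    (hf : Covering f) {y : Q} (g : q.obj ⟶ y) :
    g = ⨆ i, invol (f i).hom ≫ (f i).hom ≫ g := by
  apply le_antisymm
  · calc g = 𝟙 _ ≫ g := by simp
      _ ≤ (⨆ i, invol (f i).hom ≫ (f i).hom) ≫ g := comp_le_comp hf le_rfl
      _ = _ := by simp only [iSup_comp, Category.assoc]
  · refine iSup_le fun i => ?_
    calc invol (f i).hom ≫ (f i).hom ≫ g = (invol (f i).hom ≫ (f i).hom) ≫ g := by simp
      _ ≤ 𝟙 _ ≫ g := comp_le_comp (f i).property.2 le_rfl
      _ = g := by simp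

theorem Covering.hom_ext {I : Type u} {x : I → MapS Q} {q : MapS Q} {f : ∀ i, x i ⟶ q}
    (hf : Covering f) {y : Q} {g h : q.obj ⟶ y} (H : ∀ i, (f i).hom ≫ g = (f i).hom ≫ h) :
    g = h := by
  rw [hf.eq_iSup g, hf.eq_iSup h]
  simp only [H]

theorem covering_id (q : MapS Q) : Covering (fun _ : PUnit.{u + 1} => 𝟙 q) :=
  le_iSup_of_le PUnit.unit (by simp [invol_id])

/-- The singleton glued from a compatible family of elements along a covering family. -/
def SymSingleton.glue (A : SymQCat Q) {q : MapS Q} {I : Type u} {x : I → MapS Q}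
    (f : ∀ i, x i ⟶ q) (hf : Covering f) (s : ∀ i, A.obj.El (x i).obj)
    (hs : ∀ i j, (f j).hom ≫ invol (f i).hom ≤ A.obj.hom (s i) (s j)) :
    SymSingleton A q.obj where
  val y a := ⨆ i, invol (f i).hom ≫ A.obj.hom a (s i)
  act a b := by
    simp only [iSup_comp, Category.assoc]
    exact iSup_mono fun i => comp_le_comp le_rfl (A.obj.comp_le _ _ _)
  unit := by
    refine hf.trans (iSup_le fun i => le_iSup₂_of_le (x i).obj (s i) ?_)
    have h : invol (f i).hom ≤ ⨆ j, invol (f j).hom ≫ A.obj.hom (s i) (s j) :=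
      le_iSup_of_le i
        (le_trans (by simp) (comp_le_comp (le_refl (invol (f i).hom)) (A.obj.id_le (s i))))
    exact comp_le_comp h (by simpa [invol_invol] using invol_mono h)
  counit a b := by
    simp only [invol_iSup, iSup_comp, comp_iSup, invol_comp, invol_invol]
    refine iSup_le fun j => iSup_le fun i => ?_
    rw [← A.property]
    calc (A.obj.hom (s i) b ≫ (f i).hom) ≫ invol (f j).hom ≫ A.obj.hom a (s j)
        = A.obj.hom (s i) b ≫ ((f i).hom ≫ invol (f j).hom) ≫ A.obj.hom a (s j) := by simp
      _ ≤ A.obj.hom (s i) b ≫ A.obj.hom (s j) (s i) ≫ A.obj.hom a (s j) :=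
        comp_le_comp le_rfl (comp_le_comp (hs j i) le_rfl)
      _ ≤ A.obj.hom (s i) b ≫ A.obj.hom a (s i) := comp_le_comp le_rfl (A.obj.comp_le _ _ _)
      _ ≤ _ := A.obj.comp_le _ _ _

/-- Since `g` is left adjoint to its involute, `g ≤ M(a,b)` already forces `M(-,b) = M(-,a)g`;
skeletality then identifies the two elements. -/
theorem CatSK.restr_eq_iff (A : CatSK Q) {x y : MapS Q} (a : A.obj.obj.El y.obj) (g : x ⟶ y)
    (b : A.obj.obj.El x.obj) : A.restr a g = b ↔ g.hom ≤ A.obj.obj.hom a b := by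
  constructor
  · rintro rfl
    rw [CatSK.hom_restr]
    exact le_trans (by simp) (comp_le_comp (le_refl g.hom) (A.obj.obj.id_le a))
  · intro h
    apply A.property.1
    intro z c
    rw [CatSK.hom_restr, SymQCat.hom_eq_of_le A.obj g a b h]

/-- Compatible families of elements of a symmetrically complete category glue uniquely. -/
theorem CatSK.existsUnique_restr_eq (A : CatSK Q) {q : MapS Q} {I : Type u} {x : I → MapS Q}
    (f : ∀ i, x i ⟶ q) (hf : Covering f) (s : ∀ i, A.obj.obj.El (x i).obj)
    (hs : ∀ i j, (f j).hom ≫ invol (f i).hom ≤ A.obj.obj.hom (s i) (s j)) :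
    ∃! t : A.obj.obj.El q.obj, ∀ i, A.restr t (f i) = s i := by
  -- The glued element is the one representing the glued singleton.
  obtain ⟨t, ht⟩ := A.property.2 q.obj (SymSingleton.glue A.obj f hf s hs)
  refine ⟨t, fun i => ?_, fun t' ht' => ?_⟩
  · rw [CatSK.restr_eq_iff, A.obj.property]
    have h : A.obj.obj.hom (s i) t = ⨆ j, invol (f j).hom ≫ A.obj.obj.hom (s i) (s j) :=
      (congrFun (congrFun (congrArg SymSingleton.val ht) (x i).obj) (s i)).symm
    rw [← invol_le_iff, h]
    exact le_iSup_of_le i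
      (le_trans (by simp) (comp_le_comp (le_refl (invol (f i).hom)) (A.obj.obj.id_le (s i))))
  -- Uniqueness: the column of any solution is prescribed after restriction along the cover, so it
  -- equals the column of the glued singleton.
  · apply A.property.1
    intro y b
    refine hf.hom_ext fun i => ?_
    rw [← CatSK.hom_restr, ht' i]
    have h : A.obj.obj.hom b t = ⨆ j, invol (f j).hom ≫ A.obj.obj.hom b (s j) :=
      (congrFun (congrFun (congrArg SymSingleton.val ht) y) b).symm
    rw [h, comp_iSup]
    apply le_antisymm
    · refine le_iSup_of_le i ?_
      rw [← Category.assoc]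
      exact le_trans (by simp) (comp_le_comp (f i).property.1 (le_refl (A.obj.obj.hom b (s i))))
    · refine iSup_le fun j => ?_
      rw [← Category.assoc]
      exact (comp_le_comp (hs j i) le_rfl).trans (A.obj.obj.comp_le _ _ _)

/-- A composite `fg` as in the condition is itself a symmetric map below `M(a,b)`; conversely such a
map factors through `c = a` with `f = id`. The supremum on the right is the entry of `∫P_A`. -/
theorem mapSupremum_iff (A : CatSK Q) : MapSupremum Q A ↔
    ∀ (x y : MapS Q) (a : A.obj.obj.El x.obj) (b : A.obj.obj.El y.obj),
      A.obj.obj.hom a b ≤ ⨆ (g : y ⟶ x) (_ : A.restr a g = b), g.hom := by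
  constructor
  · intro h x y a b
    rw [h]
    refine sSup_le ?_
    rintro _ ⟨z, c, f, g, hf, hg, rfl⟩
    refine le_iSup₂_of_le (g ≫ f) ?_ le_rfl
    rw [CatSK.restr_eq_iff]
    exact (comp_le_comp hg hf).trans (A.obj.obj.comp_le _ _ _)
  · intro h x y a b
    apply le_antisymm
    · refine (h x y a b).trans (iSup₂_le fun g hg => le_sSup ?_)
      exact ⟨x, a, 𝟙 x, g, A.obj.obj.id_le a, (CatSK.restr_eq_iff A a g b).1 hg, by simp⟩
    · refine sSup_le ?_
      rintro _ ⟨z, c, f, g, hf, hg, rfl⟩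
      exact (comp_le_comp hg hf).trans (A.obj.obj.comp_le _ _ _)

/-- The map-supremum condition makes the matrix of `∫P_A` equal to that of `A`, and symmetrization
leaves a symmetric matrix unchanged. -/
theorem symElements_fibres_hom {A : CatSK Q} (hA : MapSupremum Q A) {x y : Q}
    (a : A.obj.obj.El x) (b : A.obj.obj.El y) :
    ((symElements Q).obj ((fibres Q).obj A)).obj.hom (x := x) (y := y) a b =
      A.obj.obj.hom a b := by
  have key : ∀ {x y : Q} (a : A.obj.obj.El x) (b : A.obj.obj.El y),
      (elementsObj ((fibres Q).obj A)).hom (x := x) (y := y) a b = A.obj.obj.hom a b := by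
    intro x y a b
    apply le_antisymm
    · exact iSup₂_le fun g hg => (CatSK.restr_eq_iff A a g b).1 hg
    · exact (mapSupremum_iff A).1 hA ⟨x⟩ ⟨y⟩ a b
  change (elementsObj ((fibres Q).obj A)).hom (x := x) (y := y) a b ⊓
    invol ((elementsObj ((fibres Q).obj A)).hom (x := y) (y := x) b a) = _
  rw [key, key, ← A.obj.property, inf_idem]

theorem exists_val_eq_hom {A : CatSK Q} (hA : MapSupremum Q A) {x : Q}
    (σ : SymSingleton ((symElements Q).obj ((fibres Q).obj A)) x) :
    ∃ a : A.obj.obj.El x, ∀ (y : Q) (b : A.obj.obj.El y), σ.val y b = A.obj.obj.hom b a := by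
  let τ : SymSingleton A.obj x :=
    { val := σ.val
      act := fun a b => by
        rw [← symElements_fibres_hom hA]
        exact σ.act a b
      unit := σ.unit
      counit := fun a b => by
        rw [← symElements_fibres_hom hA]
        exact σ.counit a b }
  obtain ⟨a, ha⟩ := A.property.2 x τ
  exact ⟨a, fun y b => congrFun (congrFun (congrArg SymSingleton.val ha) y) b⟩

/-- Singletons of `S∫P_A` are even globally representable, so the identity alone serves as the
cover; gluing is inherited from completeness. -/
theorem gluingCondition_fibres {A : CatSK Q} (hA : MapSupremum Q A) :
    GluingCondition Q ((fibres Q).obj A) := by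
  refine ⟨fun q σ => ?_, fun q I x f s hf hs => ?_⟩
  · obtain ⟨a, ha⟩ := exists_val_eq_hom hA σ
    refine ⟨PUnit, fun _ => q, fun _ => 𝟙 q, fun _ => a, covering_id q, fun i y b => ?_⟩
    refine (Category.id_comp _).trans ((ha y b).trans ?_)
    exact (symElements_fibres_hom hA (A := A) (x := y) (y := q.obj) b a).symm
  · refine CatSK.existsUnique_restr_eq A f hf s fun i j => ?_
    exact (hs i j).trans
      (symElements_fibres_hom hA (A := A) (x := (x i).obj) (y := (x j).obj) (s i) (s j)).le

end Completeness

/-! ### Presheaves with local representability and gluing -/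

section Presheaves

variable {Q : Type u} [InvolutiveQuantaloid Q] {F : PSh Q}

/-- The matrix entries `N(a,b)` of `∫F`. -/
def elementsHom (F : PSh Q) {x y : MapS Q} (a : F.obj (op x)) (b : F.obj (op y)) :
    y.obj ⟶ x.obj :=
  (elementsObj F).hom (x := x.obj) (y := y.obj) a b

/-- The matrix entries `M(a,b)` of `S∫F`. -/
def symElementsHom (F : PSh Q) {x y : MapS Q} (a : F.obj (op x)) (b : F.obj (op y)) :
    y.obj ⟶ x.obj :=
  ((symElements Q).obj F).obj.hom (x := x.obj) (y := y.obj) a b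

theorem symElementsHom_eq {x y : MapS Q} (a : F.obj (op x)) (b : F.obj (op y)) :
    symElementsHom F a b = elementsHom F a b ⊓ invol (elementsHom F b a) := rfl

theorem symElementsHom_comp_le {x y z : MapS Q} (a : F.obj (op x)) (b : F.obj (op y))
    (c : F.obj (op z)) : symElementsHom F b c ≫ symElementsHom F a b ≤ symElementsHom F a c :=
  ((symElements Q).obj F).obj.comp_le (x := x.obj) (y := y.obj) (z := z.obj) a b c

theorem id_le_symElementsHom {x : MapS Q} (a : F.obj (op x)) :
    𝟙 x.obj ≤ symElementsHom F a a :=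
  ((symElements Q).obj F).obj.id_le (x := x.obj) a

theorem invol_symElementsHom {x y : MapS Q} (a : F.obj (op x)) (b : F.obj (op y)) :
    invol (symElementsHom F a b) = symElementsHom F b a :=
  (((symElements Q).obj F).property y.obj x.obj b a).symm

theorem le_elementsHom {x y : MapS Q} (a : F.obj (op y)) (g : x ⟶ y) :
    g.hom ≤ elementsHom F a (F.map g.op a) :=
  le_iSup₂_of_le g rfl le_rfl

/-- Gluing along the covering family that consists of the identity and of a symmetric map `f`. -/
theorem UniqueGluing.map_eq_of_le (hF : UniqueGluing F) {x q : MapS Q} (f : x ⟶ q)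
    (s : F.obj (op q)) (t : F.obj (op x)) (h : f.hom ≤ symElementsHom F s t) :
    F.map f.op s = t := by
  -- The index `true` carries the identity with `s`, and `false` carries `f` with `t`. The lift only
  -- adjusts the universe.
  let y : ULift.{u} Bool → MapS Q := fun i => bif i.down then q else x
  let φ : ∀ i, y i ⟶ q := fun
    | ⟨true⟩ => 𝟙 q
    | ⟨false⟩ => f
  let r : ∀ i, F.obj (op (y i)) := fun
    | ⟨true⟩ => s
    | ⟨false⟩ => t
  have h' : invol f.hom ≤ symElementsHom F t s := by
    rw [← invol_symElementsHom]
    exact invol_mono h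
  have hφ : Covering φ := by
    refine le_iSup_of_le ⟨true⟩ ?_
    change 𝟙 q.obj ≤ invol (𝟙 q.obj) ≫ 𝟙 q.obj
    simp [invol_id]
  obtain ⟨w, hw, -⟩ := hF q (ULift Bool) y φ r hφ (by
    rintro ⟨_ | _⟩ ⟨_ | _⟩
    · exact (comp_le_comp h h').trans (symElementsHom_comp_le t s t)
    · change 𝟙 q.obj ≫ invol f.hom ≤ symElementsHom F t s
      simpa using h'
    · change f.hom ≫ invol (𝟙 q.obj) ≤ symElementsHom F s t
      simpa [invol_id] using h
    · change 𝟙 q.obj ≫ invol (𝟙 q.obj) ≤ symElementsHom F s s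
      simpa [invol_id] using id_le_symElementsHom s)
  have h1 : F.map (𝟙 q).op w = s := hw ⟨true⟩
  have h2 : F.map f.op w = t := hw ⟨false⟩
  rw [op_id, Functor.map_id_apply] at h1
  rw [← h1, h2]

/-- By definition `f` lies below `N(s, F(f)s)`; the symmetrized entry also needs `f° ≤ N(F(f)s, s)`.
Local representability of the singleton `M_F(-,s)f` gives a cover `g_i` and elements `t_i` with `f
g_i ≤ M_F(s,t_i)`, whose symmetry supplies the reverse inequality locally. -/
theorem GluingCondition.le_symElementsHom (hF : GluingCondition Q F) {x q : MapS Q} (f : x ⟶ q)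
    (s : F.obj (op q)) : f.hom ≤ symElementsHom F s (F.map f.op s) := by
  obtain ⟨I, y, g, t, hg, ht⟩ := hF.1 x
    (SymSingleton.ofMap ((symElements Q).obj F) (y := q) s f)
  have ht' : ∀ i, (g i ≫ f).hom ≤ symElementsHom F s (t i) := by
    intro i
    have h : (g i).hom ≫ f.hom ≫ symElementsHom F s s = symElementsHom F s (t i) :=
      ht i q.obj s
    rw [← h]
    exact comp_le_comp le_rfl
      (le_trans (by simp) (comp_le_comp (le_refl f.hom) (id_le_symElementsHom s)))
  have hst : ∀ i, F.map (g i).op (F.map f.op s) = t i := by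
    intro i
    rw [← hF.2.map_eq_of_le (g i ≫ f) s (t i) (ht' i), op_comp, Functor.map_comp_apply]
  rw [symElementsHom_eq]
  refine le_inf (le_elementsHom s f) (invol_le_iff.1 ?_)
  -- Insert the cover: `g_i g_i° f° ≤ N(F(f)s, t_i) N(t_i, s)`, where the first factor uses that
  -- `t_i` is the restriction of `F(f)s` along `g_i`.
  calc invol f.hom = invol f.hom ≫ 𝟙 _ := by simp
    _ ≤ invol f.hom ≫ ⨆ i, invol (g i).hom ≫ (g i).hom := comp_le_comp le_rfl hg
    _ ≤ _ := by
      rw [comp_iSup]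
      refine iSup_le fun i => ?_
      have h1 : invol f.hom ≫ invol (g i).hom ≤ elementsHom F (t i) s := by
        rw [← invol_comp]
        exact (invol_mono (ht' i)).trans (invol_le_iff.2 inf_le_right)
      have h2 : (g i).hom ≤ elementsHom F (F.map f.op s) (t i) := by
        rw [← hst i]
        exact le_elementsHom _ _
      rw [← Category.assoc]
      exact (comp_le_comp h1 h2).trans ((elementsObj F).comp_le (x := x.obj) (y := (y i).obj)
        (z := q.obj) (F.map f.op s) (t i) s)

theorem GluingCondition.map_eq_iff (hF : GluingCondition Q F) {x q : MapS Q} (f : x ⟶ q)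
    (s : F.obj (op q)) (t : F.obj (op x)) :
    F.map f.op s = t ↔ f.hom ≤ symElementsHom F s t := by
  constructor
  · rintro rfl
    exact hF.le_symElementsHom f s
  · exact hF.2.map_eq_of_le f s t

theorem GluingCondition.symElementsHom_map (hF : GluingCondition Q F) {x y q : MapS Q} (f : x ⟶ q)
    (s : F.obj (op q)) (a : F.obj (op y)) :
    symElementsHom F a (F.map f.op s) = f.hom ≫ symElementsHom F a s :=
  SymQCat.hom_eq_of_le ((symElements Q).obj F) f s (F.map f.op s) (hF.le_symElementsHom f s)
    (z := y.obj) a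

/-- The local representatives of a singleton are compatible, and their gluing represents it because
columns are determined on a cover. Skeletality is the translation lemma for an identity map. -/
theorem GluingCondition.isSymComplete (hF : GluingCondition Q F) :
    IsSymComplete ((symElements Q).obj F) := by
  refine ⟨fun x a a' h => ?_, fun q σ => ?_⟩
  · have h1 : 𝟙 x ≤ symElementsHom F (x := ⟨x⟩) (y := ⟨x⟩) a a' :=
      (id_le_symElementsHom (x := ⟨x⟩) a).trans (h x a).le
    have h2 := hF.2.map_eq_of_le (𝟙 (⟨x⟩ : MapS Q)) a a' h1
    exact (Functor.map_id_apply F _ _).symm.trans h2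
  · obtain ⟨I, x, f, s, hf, hs⟩ := hF.1 ⟨q⟩ σ
    replace hs : ∀ i (y : MapS Q) (a : F.obj (op y)),
        (f i).hom ≫ σ.val y.obj a = symElementsHom F a (s i) := fun i y a => hs i y.obj a
    -- The adjoint form of `id ≤ M_F(s_i,s_i) = σ(s_i)f_i`; composing with `f_j` yields the
    -- compatibility of the `s_i`.
    have hσ : ∀ i, invol (f i).hom ≤ σ.val (x i).obj (s i) := by
      intro i
      calc invol (f i).hom = invol (f i).hom ≫ 𝟙 _ := by simp
        _ ≤ invol (f i).hom ≫ (f i).hom ≫ σ.val (x i).obj (s i) :=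
          comp_le_comp le_rfl ((id_le_symElementsHom (s i)).trans (hs i (x i) (s i)).ge)
        _ = (invol (f i).hom ≫ (f i).hom) ≫ σ.val (x i).obj (s i) := by simp
        _ ≤ 𝟙 _ ≫ σ.val (x i).obj (s i) := comp_le_comp (f i).property.2 le_rfl
        _ = _ := by simp
    obtain ⟨t, ht, -⟩ := hF.2 ⟨q⟩ I x f s hf fun i j =>
      (comp_le_comp le_rfl (hσ i)).trans (hs j (x i) (s i)).le
    refine ⟨t, ?_⟩
    apply SymSingleton.ext
    funext y a
    refine hf.hom_ext fun i => ?_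
    have h : symElementsHom F (x := ⟨y⟩) a (s i) =
        (f i).hom ≫ symElementsHom F (x := ⟨y⟩) (y := ⟨q⟩) a t := by
      rw [← ht i]
      exact hF.symElementsHom_map (f i) t a
    exact (hs i ⟨y⟩ a).trans h

/-- All singletons are representable, so entries of the completion are entries of `M_F`. These lie
below `N`, a supremum of symmetric maps that also act as restrictions in the completion. -/
theorem GluingCondition.mapSupremum (hF : GluingCondition Q F) :
    MapSupremum Q ((sheafification Q).obj F) := by
  rw [mapSupremum_iff]
  intro x y σ τ
  obtain ⟨a, ha⟩ := hF.isSymComplete.2 x.obj σ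
  obtain ⟨b, hb⟩ := hF.isSymComplete.2 y.obj τ
  subst ha hb
  have h := singletonCat_hom_repr ((symElements Q).obj F) (y := x.obj) a
    (SymSingleton.repr ((symElements Q).obj F) (x := y.obj) b)
  refine (h.trans_le inf_le_left).trans ?_
  refine iSup₂_le fun g hg => le_iSup₂_of_le g ?_ le_rfl
  exact (CatSK.restr_eq_iff ((sheafification Q).obj F) _ g _).2
    (((hF.map_eq_iff g a b).1 hg).trans h.ge)

end Presheaves

/-! ### Unit, counit and the adjoint equivalence -/

section Adjunction

variable {Q : Type u} [InvolutiveQuantaloid Q]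

/-- Yoneda for `f_!`; it reduces naturality and the left triangle identity to computations with
elements. -/
theorem SymSingleton.push_repr {A B : SymQCat Q} (f : A ⟶ B) {x : Q} (a : A.obj.El x) :
    SymSingleton.push f (SymSingleton.repr A a) = SymSingleton.repr B (f.hom.map x a) := by
  apply SymSingleton.ext
  funext y b
  apply le_antisymm
  · exact iSup₂_le fun z c => (comp_le_comp (QCat.Hom.hom_le f.hom c a) le_rfl).trans
      (B.obj.comp_le _ _ _)
  · refine le_iSup₂_of_le x a ?_
    exact (Category.id_comp _).ge.trans (comp_le_comp (A.obj.id_le a) le_rfl)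

/-- The unit `a ↦ M(-,a)`. -/
noncomputable def sheafificationUnit {F : PSh Q} (hF : GluingCondition Q F) :
    F ⟶ (fibres Q).obj ((sheafification Q).obj F) where
  app x := TypeCat.ofHom fun a =>
    SymSingleton.repr ((symElements Q).obj F) (x := x.unop.obj) a
  naturality := by
    intro y x g
    ext a
    symm
    refine (CatSK.restr_eq_iff ((sheafification Q).obj F) (x := x.unop) (y := y.unop)
      (SymSingleton.repr ((symElements Q).obj F) (x := y.unop.obj) a) g.unop
      (SymSingleton.repr ((symElements Q).obj F) (x := x.unop.obj) (F.map g a))).2 ?_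
    refine (hF.le_symElementsHom g.unop a).trans (Eq.ge ?_)
    exact singletonCat_hom_repr ((symElements Q).obj F) (y := y.unop.obj) a
      (SymSingleton.repr ((symElements Q).obj F) (x := x.unop.obj) (F.map g a))

theorem sheafificationUnit_bijective {F : PSh Q} (hF : GluingCondition Q F) (x : (MapS Q)ᵒᵖ) :
    Function.Bijective ((sheafificationUnit hF).app x) := by
  refine ⟨fun a b h => ?_, fun σ => ?_⟩
  · exact hF.isSymComplete.1 x.unop.obj a b fun y c =>
      congrFun (congrFun (congrArg SymSingleton.val h) y) c
  · obtain ⟨a, ha⟩ := hF.isSymComplete.2 x.unop.obj σ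
    exact ⟨a, ha.symm⟩

/-- The element represented by a singleton of `S∫P_A`. -/
noncomputable def representingElement {A : CatSK Q} (hA : MapSupremum Q A) {x : Q}
    (σ : SymSingleton ((symElements Q).obj ((fibres Q).obj A)) x) : A.obj.obj.El x :=
  (exists_val_eq_hom hA σ).choose

theorem val_eq_hom_representingElement {A : CatSK Q} (hA : MapSupremum Q A) {x : Q}
    (σ : SymSingleton ((symElements Q).obj ((fibres Q).obj A)) x) {y : Q} (b : A.obj.obj.El y) :
    σ.val y b = A.obj.obj.hom b (representingElement hA σ) :=
  (exists_val_eq_hom hA σ).choose_spec y b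

theorem representingElement_repr {A : CatSK Q} (hA : MapSupremum Q A) {x : Q}
    (a : A.obj.obj.El x) :
    representingElement hA
      (SymSingleton.repr ((symElements Q).obj ((fibres Q).obj A)) (x := x) a) = a := by
  apply A.property.1
  intro y b
  rw [← val_eq_hom_representingElement hA]
  exact symElements_fibres_hom hA b a

theorem repr_representingElement {A : CatSK Q} (hA : MapSupremum Q A) {x : Q}
    (σ : SymSingleton ((symElements Q).obj ((fibres Q).obj A)) x) :
    SymSingleton.repr ((symElements Q).obj ((fibres Q).obj A)) (x := x)
      (representingElement hA σ) = σ := by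
  apply SymSingleton.ext
  funext y b
  exact (symElements_fibres_hom hA b _).trans (val_eq_hom_representingElement hA σ b).symm

/-- The counit, which sends `M(-,a)` to `a`. -/
noncomputable def sheafificationCounit {A : CatSK Q} (hA : MapSupremum Q A) :
    (sheafification Q).obj ((fibres Q).obj A) ⟶ A :=
  ObjectProperty.homMk (ObjectProperty.homMk
    { map := fun _ σ => representingElement hA σ
      hom_le := by
        intro x y σ τ
        refine iSup₂_le fun z c => ?_
        have hσ : invol (SymSingleton.val σ z c) =
            A.obj.obj.hom (representingElement hA σ) c :=
          (congrArg invol (val_eq_hom_representingElement hA σ c)).trans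
            (A.obj.property _ _ _ _).symm
        exact (comp_le_comp (val_eq_hom_representingElement hA τ c).le hσ.le).trans
          (A.obj.obj.comp_le _ _ _) })

/-- The inverse of the counit. -/
noncomputable def sheafificationCounitInv {A : CatSK Q} (hA : MapSupremum Q A) :
    A ⟶ (sheafification Q).obj ((fibres Q).obj A) :=
  ObjectProperty.homMk (ObjectProperty.homMk
    { map := fun x a =>
        SymSingleton.repr ((symElements Q).obj ((fibres Q).obj A)) (x := x) a
      hom_le := by
        intro x y a b
        refine Eq.le ?_
        exact ((singletonCat_hom_repr ((symElements Q).obj ((fibres Q).obj A)) (y := x) a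
          (SymSingleton.repr ((symElements Q).obj ((fibres Q).obj A)) (x := y) b)).trans
          (symElements_fibres_hom hA a b)).symm })

theorem CatSK.hom_ext {A B : CatSK Q} {f g : A ⟶ B}
    (h : ∀ (x : Q) (a : A.obj.obj.El x), f.hom.hom.map x a = g.hom.hom.map x a) : f = g := by
  apply ObjectProperty.hom_ext
  apply ObjectProperty.hom_ext
  apply QCat.Hom.ext
  funext x a
  exact h x a

instance isIso_sheafificationUnit {F : PSh Q} (hF : GluingCondition Q F) :
    IsIso (sheafificationUnit hF) := by
  have : ∀ x, IsIso ((sheafificationUnit hF).app x) := fun x =>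
    (isIso_iff_bijective _).2 (sheafificationUnit_bijective hF x)
  exact NatIso.isIso_of_isIso_app _

instance isIso_sheafificationCounit {A : CatSK Q} (hA : MapSupremum Q A) :
    IsIso (sheafificationCounit hA) :=
  ⟨sheafificationCounitInv hA, CatSK.hom_ext fun _ σ => repr_representingElement hA σ,
    CatSK.hom_ext fun _ a => representingElement_repr hA a⟩

variable (Q) in
/-- The restriction of `C_s S ∫`. -/
abbrev sheafificationRestrict : PShf Q ⥤ CatSKf Q :=
  (MapSupremum Q).lift ((GluingCondition Q).ι ⋙ sheafification Q)
    (fun F => F.property.mapSupremum)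

variable (Q) in
/-- The restriction of `P`. -/
noncomputable abbrev fibresRestrict : CatSKf Q ⥤ PShf Q :=
  (GluingCondition Q).lift ((MapSupremum Q).ι ⋙ fibres Q)
    (fun A => gluingCondition_fibres A.property)

variable (Q) in
/-- The adjunction `C_s S ∫ ⊣ P` between the full subcategories. -/
noncomputable def sheafificationAdjunction : sheafificationRestrict Q ⊣ fibresRestrict Q :=
  Adjunction.mkOfUnitCounit
    { unit :=
        { app := fun F => ObjectProperty.homMk (sheafificationUnit F.property)
          naturality := by
            intro F G α
            apply ObjectProperty.hom_ext
            ext x a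
            exact (SymSingleton.push_repr ((symElements Q).map α.hom) (x := x.unop.obj) a).symm }
      counit :=
        { app := fun A => ObjectProperty.homMk (sheafificationCounit A.property)
          naturality := by
            intro A B f
            apply ObjectProperty.hom_ext
            apply CatSK.hom_ext
            intro x σ
            -- Every singleton here is representable, so naturality need only be checked on
            -- `M(-,a)`.
            obtain ⟨a, rfl⟩ : ∃ a, SymSingleton.repr _ a = σ :=
              ⟨_, repr_representingElement A.property σ⟩
            refine (congrArg (representingElement B.property) (SymSingleton.push_repr
              ((symElements Q).map ((fibres Q).map f.hom)) (x := x) a)).trans ?_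
            refine (representingElement_repr B.property _).trans ?_
            exact congrArg (f.hom.hom.hom.map x) (representingElement_repr A.property a).symm }
      left_triangle := by
        ext F : 2
        apply ObjectProperty.hom_ext
        apply CatSK.hom_ext
        intro x σ
        obtain ⟨a, rfl⟩ := F.property.isSymComplete.2 x σ
        refine (congrArg (representingElement F.property.mapSupremum) (SymSingleton.push_repr
          ((symElements Q).map (sheafificationUnit F.property)) (x := x) a)).trans ?_
        exact representingElement_repr F.property.mapSupremum _
      right_triangle := by
        ext A : 2
        apply ObjectProperty.hom_ext
        ext x a
        exact representingElement_repr A.property (x := x.unop.obj) a }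

instance (F : PShf Q) : IsIso ((sheafificationAdjunction Q).unit.app F) :=
  (ObjectProperty.isIso_hom_iff _).1 (isIso_sheafificationUnit F.property)

instance (A : CatSKf Q) : IsIso ((sheafificationAdjunction Q).counit.app A) :=
  (ObjectProperty.isIso_hom_iff _).1 (isIso_sheafificationCounit A.property)

end Adjunction
open TopologicalSpace

/-! ### Symmetric maps in `R(X)` are inclusions of open sets -/

section OpenRel

variable {X : Type u} [TopologicalSpace X]

/-- The open set underlying an arrow of `R(X)`. -/
def OpenRel.open {U V : OpenRel X} (f : U ⟶ V) : Opens X := Subtype.val f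

namespace OpenRel

variable {U V W : OpenRel X}

theorem hom_ext {f g : U ⟶ V} (h : OpenRel.open f = OpenRel.open g) : f = g := Subtype.ext h

theorem open_le_left (f : U ⟶ V) : OpenRel.open f ≤ U.carrier := le_trans f.2 inf_le_left

theorem open_le_right (f : U ⟶ V) : OpenRel.open f ≤ V.carrier := le_trans f.2 inf_le_right

/-- The arrow of `R(X)` with given underlying open set. -/
def mkHom (O : Opens X) (hU : O ≤ U.carrier) (hV : O ≤ V.carrier) : U ⟶ V := ⟨O, le_inf hU hV⟩

theorem open_iSup {ι : Sort*} (f : ι → (U ⟶ V)) :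
    OpenRel.open (⨆ i, f i) = ⨆ i, OpenRel.open (f i) := by
  change sSup (Subtype.val '' Set.range f) = _
  rw [← Set.range_comp]
  rfl

theorem open_symMap {x y : MapS (OpenRel X)} (g : x ⟶ y) :
    OpenRel.open g.hom = x.obj.carrier :=
  le_antisymm (open_le_left _) (le_trans (show _ ≤ _ from g.property.1) inf_le_left)

theorem carrier_le_of_symMap {x y : MapS (OpenRel X)} (g : x ⟶ y) :
    x.obj.carrier ≤ y.obj.carrier :=
  (open_symMap g).ge.trans (open_le_right _)

theorem symMap_hom_ext {x y : MapS (OpenRel X)} (g h : x ⟶ y) : g = h := by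
  apply WideSubcategory.hom_ext
  apply hom_ext
  rw [open_symMap, open_symMap]

end OpenRel

instance : (opensToMapS (X := X)).Faithful := ⟨fun _ => Subsingleton.elim _ _⟩

instance : (opensToMapS (X := X)).Full :=
  ⟨fun g => ⟨homOfLE (OpenRel.carrier_le_of_symMap g), OpenRel.symMap_hom_ext _ _⟩⟩

instance : (opensToMapS (X := X)).EssSurj := ⟨fun x => ⟨x.obj.carrier, ⟨Iso.refl _⟩⟩⟩

instance : (opensToMapS (X := X)).IsEquivalence where

end OpenRel

/-! ### Complete categories over `R(X)` as sheaves on `X` -/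

section Sheaves

variable {X : TopCat.{u}}

variable (X) in
/-- `P`, as a functor to presheaves on `X`. -/
noncomputable abbrev fibresOpens : CatSK (OpenRel X) ⥤ TopCat.Presheaf (Type u) X :=
  fibres (OpenRel X) ⋙ (Functor.whiskeringLeft _ _ (Type u)).obj (opensToMapS (X := X)).op

/-- The open set underlying a matrix entry of a category over `R(X)`. -/
def QCat.homOpen (A : QCat (OpenRel X)) {U V : OpenRel X} (a : A.El U) (b : A.El V) : Opens X :=
  OpenRel.open (A.hom a b)

theorem CatSK.homOpen_restr (A : CatSK (OpenRel X)) {U V : Opens X} (h : U ≤ V)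
    (a : A.obj.obj.El (OpenRel.of V)) {W : OpenRel X} (b : A.obj.obj.El W) :
    A.obj.obj.homOpen b (A.restr a (opensToMapS.map (homOfLE h))) = U ⊓ A.obj.obj.homOpen b a :=
  congrArg OpenRel.open (CatSK.hom_restr A a (opensToMapS.map (homOfLE h)) b)

theorem SymQCat.homOpen_comm (A : SymQCat (OpenRel X)) {U V : OpenRel X} (a : A.obj.El U)
    (b : A.obj.El V) : A.obj.homOpen a b = A.obj.homOpen b a :=
  congrArg OpenRel.open (A.property _ _ a b)

theorem QCat.homOpen_self (A : QCat (OpenRel X)) {U : OpenRel X} (a : A.El U) :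
    A.homOpen a a = U.carrier :=
  le_antisymm (OpenRel.open_le_left _) (A.id_le a)

theorem QCat.homOpen_inf_le (A : QCat (OpenRel X)) {U V W : OpenRel X} (a : A.El U) (b : A.El V)
    (c : A.El W) : A.homOpen b c ⊓ A.homOpen a b ≤ A.homOpen a c := A.comp_le a b c

/-- Restricting to `W` intersects a column with `W`. On `W ≤ M(a,b)` the columns of `a` and `b`
agree by transitivity; conversely both elements overlap their common restriction in all of `W`. -/
theorem CatSK.le_homOpen_iff (A : CatSK (OpenRel X)) {U V W : Opens X} (hU : W ≤ U) (hV : W ≤ V)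
    (a : A.obj.obj.El (OpenRel.of U)) (b : A.obj.obj.El (OpenRel.of V)) :
    W ≤ A.obj.obj.homOpen a b ↔
      A.restr a (opensToMapS.map (homOfLE hU)) = A.restr b (opensToMapS.map (homOfLE hV)) := by
  constructor
  · intro h
    apply A.property.1
    intro y c
    apply OpenRel.hom_ext
    change A.obj.obj.homOpen _ _ = A.obj.obj.homOpen _ _
    rw [homOpen_restr, homOpen_restr]
    apply le_antisymm
    · exact le_inf inf_le_left ((inf_le_inf_right _ h).trans (A.obj.obj.homOpen_inf_le c a b))
    · rw [A.obj.homOpen_comm] at h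
      exact le_inf inf_le_left ((inf_le_inf_right _ h).trans (A.obj.obj.homOpen_inf_le c b a))
  · intro h
    have h1 := A.homOpen_restr hU a a
    have h2 := A.homOpen_restr hV b b
    rw [A.obj.obj.homOpen_self, inf_eq_left.2 hU] at h1
    rw [A.obj.obj.homOpen_self, inf_eq_left.2 hV, ← h, A.obj.homOpen_comm] at h2
    exact (le_inf h2.ge h1.ge).trans (A.obj.obj.homOpen_inf_le _ _ _)

theorem isSheaf_fibresOpens (A : CatSK (OpenRel X)) : ((fibresOpens X).obj A).IsSheaf := by
  rw [TopCat.Presheaf.isSheaf_iff_isSheafUniqueGluing_types]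
  intro I U s hs
  refine CatSK.existsUnique_restr_eq A (q := opensToMapS.obj (iSup U))
    (x := fun i => opensToMapS.obj (U i)) (fun i => opensToMapS.map (Opens.leSupr U i)) ?_ s ?_
  · change iSup U ≤ OpenRel.open _
    rw [OpenRel.open_iSup]
    exact iSup_mono fun i => le_inf le_rfl le_rfl
  · intro i j
    have h := (A.le_homOpen_iff (inf_le_left : U i ⊓ U j ≤ U i) inf_le_right (s i) (s j)).2
      (hs i j)
    -- The composite of `f_i°` with `f_j` is the intersection in the opposite order.
    rw [inf_comm] at h
    exact h

instance : (fibresOpens X).Faithful where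
  map_injective {A B} f g h := by
    apply CatSK.hom_ext
    intro U a
    exact ConcreteCategory.congr_hom (congrArg (fun α => NatTrans.app α (op U.carrier)) h) a

/-- A natural transformation preserves equality of restrictions, hence enlarges the locus of
agreement `M(a,b)`: it is automatically a functor of enriched categories. -/
instance : (fibresOpens X).Full where
  map_surjective {A B} α := by
    have hα : ∀ {U V : Opens X} (h : U ≤ V) (a : A.obj.obj.El (OpenRel.of V)),
        α.app (op U) (A.restr a (opensToMapS.map (homOfLE h))) =
          B.restr (α.app (op V) a) (opensToMapS.map (homOfLE h)) := fun h a =>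
      NatTrans.naturality_apply α (homOfLE h).op a
    refine ⟨ObjectProperty.homMk (ObjectProperty.homMk
      { map := fun U a => α.app (op U.carrier) a
        hom_le := ?_ }), rfl⟩
    intro U V a b
    have hU : A.obj.obj.homOpen a b ≤ U.carrier := OpenRel.open_le_right _
    have hV : A.obj.obj.homOpen a b ≤ V.carrier := OpenRel.open_le_left _
    refine (B.le_homOpen_iff hU hV (α.app (op U.carrier) a) (α.app (op V.carrier) b)).2 ?_
    exact (hα hU a).symm.trans
      ((congrArg _ ((A.le_homOpen_iff hU hV a b).1 le_rfl)).trans (hα hV b))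

/-! ### The enriched category of sections of a sheaf -/

variable {F : TopCat.Presheaf (Type u) X}

/-- The largest open set on which two sections of a presheaf agree. -/
def agree (F : TopCat.Presheaf (Type u) X) {U V : Opens X} (a : F.obj (op U)) (b : F.obj (op V)) :
    Opens X :=
  ⨆ (W : Opens X) (_ : ∃ (hU : W ≤ U) (hV : W ≤ V),
    F.map (homOfLE hU).op a = F.map (homOfLE hV).op b), W

theorem map_map_homOfLE {U V W : Opens X} (h : U ≤ V) (h' : V ≤ W) (a : F.obj (op W)) :
    F.map (homOfLE h).op (F.map (homOfLE h').op a) = F.map (homOfLE (h.trans h')).op a :=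
  (Functor.map_comp_apply F (homOfLE h').op (homOfLE h).op a).symm

theorem map_homOfLE_refl {U : Opens X} (a : F.obj (op U)) :
    F.map (homOfLE (le_refl U)).op a = a :=
  Functor.map_id_apply F _ a

theorem agree_le_left {U V : Opens X} (a : F.obj (op U)) (b : F.obj (op V)) :
    agree F a b ≤ U :=
  iSup₂_le fun _ h => h.1

theorem agree_le_right {U V : Opens X} (a : F.obj (op U)) (b : F.obj (op V)) :
    agree F a b ≤ V :=
  iSup₂_le fun _ h => h.2.1

theorem le_agree {U V W : Opens X} (hU : W ≤ U) (hV : W ≤ V) {a : F.obj (op U)}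
    {b : F.obj (op V)} (h : F.map (homOfLE hU).op a = F.map (homOfLE hV).op b) :
    W ≤ agree F a b :=
  le_iSup₂_of_le W ⟨hU, hV, h⟩ le_rfl

theorem agree_comm {U V : Opens X} (a : F.obj (op U)) (b : F.obj (op V)) :
    agree F a b = agree F b a :=
  le_antisymm (iSup₂_le fun _ ⟨hU, hV, h⟩ => le_agree hV hU h.symm)
    (iSup₂_le fun _ ⟨hU, hV, h⟩ => le_agree hV hU h.symm)

theorem agree_inf_le {U V W : Opens X} (a : F.obj (op U)) (b : F.obj (op V)) (c : F.obj (op W)) :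
    agree F b c ⊓ agree F a b ≤ agree F a c := by
  -- Heyting implication isolates one supremum at a time, leaving single open sets `O` and `O'` on
  -- which equality is transitive.
  refine le_himp_iff.1 (iSup₂_le fun O ⟨hV, hW, h⟩ => ?_)
  rw [le_himp_iff', ← le_himp_iff]
  refine iSup₂_le fun O' ⟨hU, hV', h'⟩ => ?_
  rw [le_himp_iff']
  refine le_agree (inf_le_right.trans hU) (inf_le_left.trans hW) ?_
  rw [← map_map_homOfLE inf_le_right hU, h', map_map_homOfLE, ← map_map_homOfLE inf_le_left hW,
    ← h, map_map_homOfLE]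

theorem agree_self {U : Opens X} (a : F.obj (op U)) : agree F a a = U :=
  le_antisymm (agree_le_left a a) (le_agree le_rfl le_rfl rfl)

/-- Separatedness: the open sets on which `a` and `b` agree cover `W`. -/
theorem map_eq_of_le_agree (hF : F.IsSheaf) {U V W : Opens X} (hU : W ≤ U) (hV : W ≤ V)
    {a : F.obj (op U)} {b : F.obj (op V)} (h : W ≤ agree F a b) :
    F.map (homOfLE hU).op a = F.map (homOfLE hV).op b := by
  let I := {O : Opens X // ∃ (hU : O ≤ U) (hV : O ≤ V),
    F.map (homOfLE hU).op a = F.map (homOfLE hV).op b}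
  refine TopCat.Sheaf.eq_of_locally_eq' ⟨F, hF⟩ (fun i : I => W ⊓ i.1) W
    (fun i => homOfLE inf_le_left) ?_ _ _ ?_
  · calc W ≤ W ⊓ agree F a b := le_inf le_rfl h
      _ = W ⊓ ⨆ i : I, i.1 := by rw [iSup_subtype]; rfl
      _ ≤ _ := by rw [inf_iSup_eq]
  · rintro ⟨O, hU', hV', h'⟩
    change F.map (homOfLE _).op (F.map (homOfLE hU).op a) =
      F.map (homOfLE _).op (F.map (homOfLE hV).op b)
    rw [map_map_homOfLE, map_map_homOfLE]
    exact (map_map_homOfLE inf_le_right hU' a).symm.trans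
      ((congrArg _ h').trans (map_map_homOfLE inf_le_right hV' b))

variable (F) in
/-- The symmetric category over `R(X)` of the sections of a presheaf. -/
def sectionsCat : SymQCat (OpenRel X) where
  obj :=
    { El := fun U => F.obj (op U.carrier)
      hom := fun a b => OpenRel.mkHom (agree F a b) (agree_le_right a b) (agree_le_left a b)
      comp_le := fun a b c => agree_inf_le a b c
      id_le := fun a => (agree_self a).ge }
  property := fun _ _ a b => OpenRel.hom_ext (agree_comm a b)

/-- For a singleton `σ`, the open sets `σ(a)` cover its type by `unit`, and the restrictions of `a`
to `σ(a)` match by `counit`; the glued section represents `σ`. -/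
theorem isSymComplete_sectionsCat (hF : F.IsSheaf) : IsSymComplete (sectionsCat F) := by
  refine ⟨fun U a a' h => ?_, fun U σ => ?_⟩
  · have h1 : agree F a a = agree F a a' := congrArg OpenRel.open (h U a)
    have h2 := map_eq_of_le_agree hF le_rfl le_rfl ((agree_self (F := F) a).ge.trans h1.le)
    exact (map_homOfLE_refl a).symm.trans (h2.trans (map_homOfLE_refl a'))
  · let I := Σ V : Opens X, F.obj (op V)
    let D : I → Opens X := fun i => OpenRel.open (σ.val (OpenRel.of i.1) i.2)
    have hD : ∀ i, D i ≤ i.1 := fun i => OpenRel.open_le_right _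
    have hDU : ∀ i, D i ≤ U.carrier := fun i => OpenRel.open_le_left _
    have hcov : U.carrier ≤ iSup D := by
      have h : U.carrier ≤ OpenRel.open _ := σ.unit
      simp only [OpenRel.open_iSup] at h
      exact h.trans (iSup₂_le fun V a => le_iSup_of_le ⟨V.carrier, a⟩ inf_le_left)
    have hact : ∀ i j : I, D j ⊓ agree F i.2 j.2 ≤ D i := fun i j =>
      σ.act (y := OpenRel.of i.1) (z := OpenRel.of j.1) i.2 j.2
    have hcounit : ∀ i j : I, D j ⊓ D i ≤ agree F i.2 j.2 := fun i j =>
      σ.counit (y := OpenRel.of i.1) (z := OpenRel.of j.1) i.2 j.2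
    obtain ⟨s, hs, -⟩ := TopCat.Sheaf.existsUnique_gluing' ⟨F, hF⟩ D U.carrier
      (fun i => homOfLE (hDU i)) hcov (fun i => F.map (homOfLE (hD i)).op i.2) (by
        intro i j
        change F.map (homOfLE _).op (F.map (homOfLE _).op i.2) =
          F.map (homOfLE _).op (F.map (homOfLE _).op j.2)
        rw [map_map_homOfLE, map_map_homOfLE]
        apply map_eq_of_le_agree hF
        rw [inf_comm]
        exact hcounit i j)
    have hDs : ∀ i, D i ≤ agree F i.2 s := fun i => le_agree (hD i) (hDU i) (hs i).symm
    refine ⟨s, ?_⟩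
    apply SymSingleton.ext
    funext V a
    apply OpenRel.hom_ext
    apply le_antisymm
    · exact hDs ⟨V.carrier, a⟩
    · change agree F a s ≤ D ⟨V.carrier, a⟩
      -- Cover the locus where `a` meets `s` by the sets `D i`. There `a` agrees with `s`, hence
      -- with the section `i.2`, and the action inequality gives membership in `σ(a)`.
      calc agree F a s ≤ iSup D ⊓ agree F a s := le_inf ((agree_le_right a s).trans hcov) le_rfl
        _ = ⨆ i, D i ⊓ agree F a s := iSup_inf_eq _ _
        _ ≤ _ := by
          refine iSup_le fun i => ?_
          refine le_trans (le_inf inf_le_left ?_) (hact ⟨V.carrier, a⟩ i)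
          refine le_trans ?_ (agree_inf_le a s i.2)
          rw [agree_comm s]
          exact inf_le_inf_right _ (hDs i)

/-- The presheaf of fibres of the category of sections of a sheaf. -/
noncomputable def fibresOpensSectionsIso (hF : F.IsSheaf) :
    (fibresOpens X).obj ⟨sectionsCat F, isSymComplete_sectionsCat hF⟩ ≅ F :=
  NatIso.ofComponents (fun _ => Iso.refl _) (by
    intro V U i
    ext a
    refine (CatSK.restr_eq_iff ⟨sectionsCat F, isSymComplete_sectionsCat hF⟩
      a (opensToMapS.map i.unop) (F.map i a)).2 ?_
    exact le_agree (leOfHom i.unop) le_rfl (map_homOfLE_refl (F.map i a)).symm)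

/-! ### The equivalence with sheaves, and the main theorem -/

variable (X) in
/-- `P`, as a functor to sheaves on `X`. -/
noncomputable def fibresSheaf : CatSK (OpenRel X) ⥤ TopCat.Sheaf (Type u) X where
  obj A := ⟨(fibresOpens X).obj A, isSheaf_fibresOpens A⟩
  map f := ⟨(fibresOpens X).map f⟩
  map_id A := by
    apply ObjectProperty.hom_ext
    exact (fibresOpens X).map_id A
  map_comp f g := by
    apply ObjectProperty.hom_ext
    exact (fibresOpens X).map_comp f g

instance : (fibresSheaf X).Faithful where
  map_injective h := (fibresOpens X).map_injective (congrArg (fun f => f.hom) h)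

instance : (fibresSheaf X).Full where
  map_surjective f :=
    ⟨(fibresOpens X).preimage f.hom, ObjectProperty.hom_ext _ ((fibresOpens X).map_preimage f.hom)⟩

instance : (fibresSheaf X).EssSurj where
  mem_essImage G := ⟨⟨sectionsCat G.obj, isSymComplete_sectionsCat G.property⟩,
    ⟨ObjectProperty.isoMk _ (fibresOpensSectionsIso G.property)⟩⟩

instance : (fibresSheaf X).IsEquivalence where

end Sheaves

end QSheaf

theorem mainTheorem10 :
    (∀ (Q : Type u) [QSheaf.InvolutiveQuantaloid Q],
      ∃ (hL : ∀ F : QSheaf.PSh Q, QSheaf.GluingCondition Q F →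
          QSheaf.MapSupremum Q ((QSheaf.sheafification Q).obj F))
        (hP : ∀ A : QSheaf.CatSK Q, QSheaf.MapSupremum Q A →
          QSheaf.GluingCondition Q ((QSheaf.fibres Q).obj A))
        (adj :
          (QSheaf.MapSupremum Q).lift ((QSheaf.GluingCondition Q).ι ⋙ QSheaf.sheafification Q)
            (fun F => hL F.obj F.property) ⊣
          (QSheaf.GluingCondition Q).lift ((QSheaf.MapSupremum Q).ι ⋙ QSheaf.fibres Q)
            (fun A => hP A.obj A.property)),
        ((QSheaf.MapSupremum Q).lift ((QSheaf.GluingCondition Q).ι ⋙ QSheaf.sheafification Q)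
            (fun F => hL F.obj F.property)).IsEquivalence ∧
        ((QSheaf.GluingCondition Q).lift ((QSheaf.MapSupremum Q).ι ⋙ QSheaf.fibres Q)
            (fun A => hP A.obj A.property)).IsEquivalence ∧
        (∀ (F : QSheaf.PShf Q) (x : QSheaf.MapS Q) (a : F.obj.obj (op x)),
          (adj.unit.app F).hom.app (op x) a =
            QSheaf.SymSingleton.repr ((QSheaf.symElements Q).obj F.obj) (x := x.obj) a) ∧
        (∀ (A : QSheaf.CatSKf Q) (x : QSheaf.MapS Q) (a : A.obj.obj.obj.El x.obj),
          (adj.counit.app A).hom.hom.hom.map x.obj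
            (QSheaf.SymSingleton.repr
              ((QSheaf.symElements Q).obj ((QSheaf.fibres Q).obj A.obj)) (x := x.obj) a) = a)) ∧
    (∀ X : TopCat.{u},
      (QSheaf.opensToMapS (X := X)).IsEquivalence ∧
      ∃ e : QSheaf.CatSK (QSheaf.OpenRel X) ≌ TopCat.Sheaf (Type u) X,
        Nonempty (e.functor ⋙ TopCat.Sheaf.forget (Type u) X ≅
          QSheaf.fibres (QSheaf.OpenRel X) ⋙
            (Functor.whiskeringLeft _ _ (Type u)).obj (QSheaf.opensToMapS (X := X)).op)) := by
  refine ⟨fun Q _ => ?_, fun X => ⟨inferInstance, ?_⟩⟩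
  · refine ⟨fun F hF => hF.mapSupremum, fun A hA => QSheaf.gluingCondition_fibres hA,
      QSheaf.sheafificationAdjunction Q, ?_, ?_, ?_, ?_⟩
    · exact (QSheaf.sheafificationAdjunction Q).toEquivalence.isEquivalence_functor
    · exact (QSheaf.sheafificationAdjunction Q).toEquivalence.isEquivalence_inverse
    · intro F x a
      rfl
    · intro A x a
      exact QSheaf.representingElement_repr A.property (x := x.obj) a
  · exact ⟨(QSheaf.fibresSheaf X).asEquivalence, ⟨Iso.refl _⟩⟩
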